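/- Proposition 3.5. Let $\mathcal V$ be a (finitary, one-sorted) variety of universal algebras, given by operations and identities, and let $\mathcal V(\mathbf{Top})$ be the category of internal $\mathcal V$-algebras in topological spaces: objects are $\mathcal V$-algebras equipped with a topology for which every operation $X^n\to X$ is continuous, and morphisms are continuous homomorphisms. If the category $\mathcal V$ is semi-abelian and satisfies (WNH), then the category $\mathcal V(\mathbf{Top})$ is pointed and satisfies (WNH). Here the following terminology is used. A category is pointed if it has a zero object. It is semi-abelian if it is pointed and Barr-exact (regular, with every internal equivalence relation a kernel pair), has binary coproducts, and is protomodular. For a pointed finitely complete category the last condition is the split short five lemma: a split extension is a diagram $X\xrightarrow{\kappa}A\underset{\beta}{\overset{\alpha}{\rightleftarrows}}B$ with $\alpha\beta=1_B$ and $\kappa$ a kernel of $\alpha$, and if in a morphism $(f,g,h)$ of split extensions (with $f$ between the kernels, $g$ between the middle objects and $h$ between the bases) both $f$ and $h$ are isomorphisms, then so is $g$. In a pointed category, a normal monomorphism is a morphism that is a kernel of some morphism. Morphisms $f:A\to C$ and $g:B\to C$ commute if the product $A\times B$ exists and there is $\varphi:A\times B\to C$ with $\varphi\langle 1,0\rangle=f$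 and $\varphi\langle 0,1\rangle=g$. A commutator of $f$ and $g$ is a morphism $[f,g]$ with codomain $C$ that is initial amongst the normal monomorphisms $n$ with codomain $C$ which have a cokernel $\operatorname{coker}(n)$ such that $\operatorname{coker}(n)f$ and $\operatorname{coker}(n)g$ commute. A pointed category satisfies (WNH) if for each normal monomorphism $k:K\to X$ for which the commutator $[1_K,1_K]$ exists, the composite $k[1_K,1_K]$ is a commutator of $k$ with itself. -/

import Mathlib

open CategoryTheory CategoryTheory.Limits FirstOrder

universe v u w

/-! ## Categorical notions

Throughout, a pointed category is a category with a zero object; its (unique) system of zero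
morphisms is carried by the type class `HasZeroMorphisms`. -/

namespace SemiAbelianWNH

section Categories

/-- `k` is a kernel of `f`. -/
def IsKernelOf {C : Type u} [Category.{v} C] [HasZeroMorphisms C]
    {K X Y : C} (k : K ⟶ X) (f : X ⟶ Y) : Prop :=
  ∃ h : k ≫ f = 0, Nonempty (IsLimit (KernelFork.ofι k h))

/-- `q` is a cokernel of `f`. -/
def IsCokernelOf {C : Type u} [Category.{v} C] [HasZeroMorphisms C]
    {X Y Q : C} (q : Y ⟶ Q) (f : X ⟶ Y) : Prop :=
  ∃ h : f ≫ q = 0, Nonempty (IsColimit (CokernelCofork.ofπ q h))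

/-- A normal monomorphism is a morphism which is the kernel of some morphism. -/
def IsNormalMonomorphism {C : Type u} [Category.{v} C] [HasZeroMorphisms C]
    {K X : C} (k : K ⟶ X) : Prop :=
  Nonempty (NormalMono k)

/-- A split extension: `κ` is a kernel of `α`, and `β` is a section of `α`. -/
structure SplitExtension (C : Type u) [Category.{v} C] [HasZeroMorphisms C] where
  {X A B : C}
  κ : X ⟶ A
  α : A ⟶ B
  β : B ⟶ A
  section_eq : β ≫ α = 𝟙 B
  isKernel : IsKernelOf κ α

/-- A morphism of split extensions. -/
structure SplitExtension.Hom {C : Type u} [Category.{v} C] [HasZeroMorphisms C]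
    (S T : SplitExtension C) where
  f : S.X ⟶ T.X
  g : S.A ⟶ T.A
  h : S.B ⟶ T.B
  comm_κ : S.κ ≫ g = f ≫ T.κ
  comm_β : S.β ≫ g = h ≫ T.β
  comm_α : S.α ≫ h = g ≫ T.α

/-- A pointed protomodular category: pointed, finitely complete, and satisfying the
split short five lemma. -/
structure IsPointedProtomodular (C : Type u) [Category.{v} C] [HasZeroMorphisms C] : Prop where
  hasZeroObject : HasZeroObject C
  hasFiniteLimits : HasFiniteLimits C
  splitShortFive : ∀ (S T : SplitExtension C) (φ : SplitExtension.Hom S T),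
    IsIso φ.f → IsIso φ.h → IsIso φ.g

/-- A Barr-exact category: regular, and every internal equivalence relation is a kernel pair. -/
structure IsBarrExact (C : Type u) [Category.{v} C] : Prop where
  regular : Regular C
  effective : ∀ {R X : C} (p₁ p₂ : R ⟶ X), IsEquivalenceRelation p₁ p₂ →
    ∃ (Y : C) (f : X ⟶ Y), IsKernelPair f p₁ p₂

/-- A semi-abelian category. -/
structure IsSemiAbelian (C : Type u) [Category.{v} C] [HasZeroMorphisms C] : Prop where
  protomodular : IsPointedProtomodular C
  exact : IsBarrExact C
  hasBinaryCoproducts : HasBinaryCoproducts C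

/-- `f : A ⟶ X` and `g : B ⟶ X` (Huq-)commute: for a product `A × B` there is `φ : A × B ⟶ X`
with `⟨1,0⟩ ≫ φ = f` and `⟨0,1⟩ ≫ φ = g`. -/
def HuqCommute {C : Type u} [Category.{v} C] [HasZeroMorphisms C]
    {A B X : C} (f : A ⟶ X) (g : B ⟶ X) : Prop :=
  ∃ (P : BinaryFan A B) (hP : IsLimit P) (φ : P.pt ⟶ X),
    hP.lift (BinaryFan.mk (𝟙 A) (0 : A ⟶ B)) ≫ φ = f ∧
    hP.lift (BinaryFan.mk (0 : B ⟶ A) (𝟙 B)) ≫ φ = g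

/-- The morphisms `f` and `g` commute after composition with the cokernel of `n`. -/
def CommuteModulo {C : Type u} [Category.{v} C] [HasZeroMorphisms C]
    {A B N X : C} (n : N ⟶ X) (f : A ⟶ X) (g : B ⟶ X) : Prop :=
  ∃ (Q : C) (q : X ⟶ Q), IsCokernelOf q n ∧ HuqCommute (f ≫ q) (g ≫ q)

/-- `c` is a Huq commutator of `f` and `g`: it is initial amongst the normal monomorphisms `n` with
codomain `X` such that `coker n ∘ f` and `coker n ∘ g` commute. -/
structure IsHuqCommutator {C : Type u} [Category.{v} C] [HasZeroMorphisms C]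
    {A B D X : C} (f : A ⟶ X) (g : B ⟶ X) (c : D ⟶ X) : Prop where
  normal : IsNormalMonomorphism c
  commute : CommuteModulo c f g
  initial : ∀ {N : C} (n : N ⟶ X), IsNormalMonomorphism n → CommuteModulo n f g →
    ∃! t : D ⟶ N, t ≫ n = c

/-- Condition (WNH): for each normal monomorphism `k : K ⟶ X`, if `c` is a commutator of `1_K` with
itself then `k ∘ c` is a commutator of `k` with itself. -/
def WNH (C : Type u) [Category.{v} C] [HasZeroMorphisms C] : Prop :=
  ∀ {K X : C} (k : K ⟶ X), IsNormalMonomorphism k →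
    ∀ {D : C} (c : D ⟶ K), IsHuqCommutator (𝟙 K) (𝟙 K) c → IsHuqCommutator k k (c ≫ k)

end Categories

/-! ## Varieties of algebras, and their internal algebras in topological spaces

A variety is given by a finitary signature, that is a first-order language `L` without relation
symbols, and a set `E` of pairs of terms (the identities), in countably many variables. -/

section Varieties

/-- The `L`-structure `M` satisfies all the identities in `E`. -/
def Satisfies {L : FirstOrder.Language.{u, w}} (E : Set (L.Term ℕ × L.Term ℕ))
    (M : Type u) [L.Structure M] : Prop :=
  ∀ e ∈ E, ∀ x : ℕ → M, e.1.realize x = e.2.realize x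

/-- An algebra of the variety defined by the identities `E`. -/
structure Alg {L : FirstOrder.Language.{u, w}} (E : Set (L.Term ℕ × L.Term ℕ)) : Type (max (u + 1) w) where
  carrier : Type u
  [str : L.Structure carrier]
  satisfies : Satisfies E carrier

attribute [instance] Alg.str

/-- Homomorphisms of algebras. -/
@[ext]
structure Alg.Hom {L : FirstOrder.Language.{u, w}} {E : Set (L.Term ℕ × L.Term ℕ)} (A B : Alg E) :
    Type u where
  hom : A.carrier →[L] B.carrier

/-- The variety defined by `E`, as a category. -/
instance Alg.category {L : FirstOrder.Language.{u, w}} {E : Set (L.Term ℕ × L.Term ℕ)} : Category.{u} (Alg E) where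
  Hom A B := Alg.Hom A B
  id A := ⟨FirstOrder.Language.Hom.id L A.carrier⟩
  comp f g := ⟨g.hom.comp f.hom⟩

/-- An internal algebra, in topological spaces, of the variety defined by `E`: a topological space
with an algebra structure all of whose operations `X × ⋯ × X → X` are continuous. -/
structure TopAlg {L : FirstOrder.Language.{u, w}} (E : Set (L.Term ℕ × L.Term ℕ)) :
    Type (max (u + 1) w) where
  carrier : Type u
  [str : L.Structure carrier]
  [top : TopologicalSpace carrier]
  continuous_op : ∀ {n : ℕ} (s : L.Functions n),
    Continuous (fun x : Fin n → carrier => FirstOrder.Language.Structure.funMap s x)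
  satisfies : Satisfies E carrier

attribute [instance] TopAlg.str TopAlg.top

/-- Continuous homomorphisms of topological algebras. -/
@[ext]
structure TopAlg.Hom {L : FirstOrder.Language.{u, w}} {E : Set (L.Term ℕ × L.Term ℕ)} (A B : TopAlg E) :
    Type u where
  hom : A.carrier →[L] B.carrier
  continuous_hom : Continuous hom

/-- The category of internal algebras in topological spaces. -/
instance TopAlg.category {L : FirstOrder.Language.{u, w}} {E : Set (L.Term ℕ × L.Term ℕ)} : Category.{u} (TopAlg E) where
  Hom A B := TopAlg.Hom A B
  id A := ⟨FirstOrder.Language.Hom.id L A.carrier, continuous_id⟩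
  comp f g := ⟨g.hom.comp f.hom, g.continuous_hom.comp f.continuous_hom⟩

end Varieties

end SemiAbelianWNH

/-! The forgetful functor from topological algebras to algebras has discrete and indiscrete
topologies as its left and right adjoints, and admits initial lifts. Hence kernels and cokernels are
preserved, cokernels lift, and a normal monomorphism of topological algebras is a continuous
homomorphism with the induced topology whose underlying homomorphism is normal.

The real point is that Huq-commutation is reflected: the homomorphism `φ` out of `A × B` must be
continuous. Applied to free algebras on one generator, the split short five lemma yields a term `t`
with `t(x,0) = x = t(0,x)` (`exists_jonssonTarski_term`). Then `(a,b) = t((a,0),(0,b))`, so `φ(a,b)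
= t(f a, g b)` is continuous (`huqCommute_of_algHom`).

So a commutator of topological algebras is an underlying commutator with the induced topology
(`isHuqCommutator_iff`), and (WNH) transfers because inducing maps compose. -/

namespace SemiAbelianWNH

/-! ### Universal properties as unique existence, ready for transport between categories -/

section UniversalProperties

variable {C : Type u} [Category.{v} C] [HasZeroMorphisms C]

theorem isKernelOf_iff {K X Y : C} (k : K ⟶ X) (f : X ⟶ Y) :
    IsKernelOf k f ↔
      k ≫ f = 0 ∧ ∀ {Z : C} (h : Z ⟶ X), h ≫ f = 0 → ∃! l : Z ⟶ K, l ≫ k = h := by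
  constructor
  · rintro ⟨w, ⟨hl⟩⟩
    refine ⟨w, fun h hh => ⟨hl.lift (KernelFork.ofι h hh), hl.fac (KernelFork.ofι h hh)
      WalkingParallelPair.zero, fun m hm => Fork.IsLimit.hom_ext hl ?_⟩⟩
    exact hm.trans (hl.fac (KernelFork.ofι h hh) WalkingParallelPair.zero).symm
  · rintro ⟨w, hl⟩
    exact ⟨w, ⟨KernelFork.IsLimit.ofι k w (fun h hh => (hl h hh).choose)
      (fun h hh => (hl h hh).choose_spec.1) (fun h hh m hm => (hl h hh).choose_spec.2 m hm)⟩⟩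

theorem isCokernelOf_iff {X Y Q : C} (q : Y ⟶ Q) (f : X ⟶ Y) :
    IsCokernelOf q f ↔
      f ≫ q = 0 ∧ ∀ {Z : C} (h : Y ⟶ Z), f ≫ h = 0 → ∃! l : Q ⟶ Z, q ≫ l = h := by
  constructor
  · rintro ⟨w, ⟨hl⟩⟩
    refine ⟨w, fun h hh => ⟨hl.desc (CokernelCofork.ofπ h hh), hl.fac (CokernelCofork.ofπ h hh)
      WalkingParallelPair.one, fun m hm => Cofork.IsColimit.hom_ext hl ?_⟩⟩
    exact hm.trans (hl.fac (CokernelCofork.ofπ h hh) WalkingParallelPair.one).symm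
  · rintro ⟨w, hl⟩
    exact ⟨w, ⟨CokernelCofork.IsColimit.ofπ q w (fun h hh => (hl h hh).choose)
      (fun h hh => (hl h hh).choose_spec.1) (fun h hh m hm => (hl h hh).choose_spec.2 m hm)⟩⟩

theorem isNormalMonomorphism_iff {K X : C} (k : K ⟶ X) :
    IsNormalMonomorphism k ↔ ∃ (Y : C) (f : X ⟶ Y), IsKernelOf k f :=
  ⟨fun ⟨h⟩ => ⟨h.Z, h.g, h.w, ⟨h.isLimit⟩⟩, fun ⟨Y, f, w, ⟨h⟩⟩ => ⟨⟨Y, f, w, h⟩⟩⟩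

theorem IsNormalMonomorphism.mono {K X : C} {k : K ⟶ X} (hk : IsNormalMonomorphism k) :
    Mono k :=
  let ⟨h⟩ := hk
  mono_of_isLimit_fork h.isLimit

theorem huqCommute_iff {A B X : C} (f : A ⟶ X) (g : B ⟶ X) :
    HuqCommute f g ↔ ∃ (P : C) (p₁ : P ⟶ A) (p₂ : P ⟶ B) (i₁ : A ⟶ P) (i₂ : B ⟶ P) (φ : P ⟶ X),
      (∀ {Z : C} (a : Z ⟶ A) (b : Z ⟶ B), ∃! l : Z ⟶ P, l ≫ p₁ = a ∧ l ≫ p₂ = b) ∧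
      i₁ ≫ p₁ = 𝟙 A ∧ i₁ ≫ p₂ = 0 ∧ i₂ ≫ p₁ = 0 ∧ i₂ ≫ p₂ = 𝟙 B ∧
      i₁ ≫ φ = f ∧ i₂ ≫ φ = g := by
  constructor
  · rintro ⟨P, hP, φ, h₁, h₂⟩
    refine ⟨P.pt, P.fst, P.snd, _, _, φ, fun a b => ?_, ?_, ?_, ?_, ?_, h₁, h₂⟩
    · refine ⟨hP.lift (BinaryFan.mk a b), ⟨?_, ?_⟩, fun m hm => BinaryFan.IsLimit.hom_ext hP ?_ ?_⟩
      · exact hP.fac (BinaryFan.mk a b) ⟨.left⟩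
      · exact hP.fac (BinaryFan.mk a b) ⟨.right⟩
      · exact hm.1.trans (hP.fac (BinaryFan.mk a b) ⟨.left⟩).symm
      · exact hm.2.trans (hP.fac (BinaryFan.mk a b) ⟨.right⟩).symm
    · exact hP.fac (BinaryFan.mk (𝟙 A) 0) ⟨.left⟩
    · exact hP.fac (BinaryFan.mk (𝟙 A) 0) ⟨.right⟩
    · exact hP.fac (BinaryFan.mk 0 (𝟙 B)) ⟨.left⟩
    · exact hP.fac (BinaryFan.mk 0 (𝟙 B)) ⟨.right⟩
  · rintro ⟨P, p₁, p₂, i₁, i₂, φ, hP, h₁₁, h₁₂, h₂₁, h₂₂, h₁, h₂⟩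
    have hl : IsLimit (BinaryFan.mk p₁ p₂) := BinaryFan.IsLimit.mk _
      (fun a b => (hP a b).choose) (fun a b => (hP a b).choose_spec.1.1)
      (fun a b => (hP a b).choose_spec.1.2)
      (fun a b m hm₁ hm₂ => (hP a b).choose_spec.2 m ⟨hm₁, hm₂⟩)
    have e₁ : hl.lift (BinaryFan.mk (𝟙 A) 0) = i₁ := BinaryFan.IsLimit.hom_ext hl
      ((hl.fac (BinaryFan.mk (𝟙 A) 0) ⟨.left⟩).trans h₁₁.symm)
      ((hl.fac (BinaryFan.mk (𝟙 A) 0) ⟨.right⟩).trans h₁₂.symm)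
    have e₂ : hl.lift (BinaryFan.mk 0 (𝟙 B)) = i₂ := BinaryFan.IsLimit.hom_ext hl
      ((hl.fac (BinaryFan.mk 0 (𝟙 B)) ⟨.left⟩).trans h₂₁.symm)
      ((hl.fac (BinaryFan.mk 0 (𝟙 B)) ⟨.right⟩).trans h₂₂.symm)
    exact ⟨_, hl, φ, by rw [e₁]; exact h₁, by rw [e₂]; exact h₂⟩

end UniversalProperties

end SemiAbelianWNH

namespace SemiAbelianWNH

variable {L : FirstOrder.Language.{u, w}} {E : Set (L.Term ℕ × L.Term ℕ)}

/-- The underlying homomorphism of a morphism of algebras. -/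
abbrev Alg.fn {A B : Alg E} (f : A ⟶ B) : A.carrier →[L] B.carrier :=
  Alg.Hom.hom f

theorem Alg.hom_ext {A B : Alg E} {f g : A ⟶ B} (h : ∀ a, Alg.fn f a = Alg.fn g a) : f = g :=
  Alg.Hom.ext (FirstOrder.Language.Hom.ext h)

theorem Alg.comp_apply {A B C : Alg E} (f : A ⟶ B) (g : B ⟶ C) (a : A.carrier) :
    Alg.fn (f ≫ g) a = Alg.fn g (Alg.fn f a) := rfl

theorem Satisfies.of_injective {M N : Type u} [L.Structure M] [L.Structure N]
    (hN : Satisfies E N) (f : M →[L] N) (hf : Function.Injective f) : Satisfies E M := by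
  intro e he x
  apply hf
  rw [← FirstOrder.Language.HomClass.realize_term, ← FirstOrder.Language.HomClass.realize_term]
  exact hN e he _

/-! ### The one-element algebra and zero elements -/

section Algebraic

variable [L.IsAlgebraic]

/-- A morphism of algebras from a function that commutes with the operations. -/
def Alg.mkHom {A B : Alg E} (f : A.carrier → B.carrier)
    (hf : ∀ {n : ℕ} (s : L.Functions n) (x : Fin n → A.carrier),
      f (Language.Structure.funMap s x) = Language.Structure.funMap s (f ∘ x)) : A ⟶ B :=
  ⟨⟨f, hf, fun r => isEmptyElim r⟩⟩

/-- The one-element algebra. -/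
def Alg.triv (E : Set (L.Term ℕ × L.Term ℕ)) : Alg E :=
  letI : L.Structure PUnit.{u + 1} := ⟨fun _ _ => PUnit.unit, fun r => isEmptyElim r⟩
  ⟨PUnit, fun _ _ _ => rfl⟩

instance : Subsingleton (Alg.triv E).carrier := inferInstanceAs (Subsingleton PUnit)

/-- The unique morphism to the one-element algebra. -/
def Alg.toTriv (A : Alg E) : A ⟶ Alg.triv E :=
  Alg.mkHom (fun _ => PUnit.unit) fun _ _ => rfl

variable [HasZeroMorphisms (Alg E)]

/-- The zero element of an algebra of a pointed variety. -/
def Alg.pt (A : Alg E) : A.carrier := Alg.fn (0 : Alg.triv E ⟶ A) PUnit.unit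

/-- The zero morphism factors through the one-element algebra. -/
theorem Alg.zero_apply {A B : Alg E} (a : A.carrier) : Alg.fn (0 : A ⟶ B) a = B.pt := by
  have : (0 : A ⟶ B) = A.toTriv ≫ (0 : Alg.triv E ⟶ B) := by simp
  rw [this]; rfl

theorem Alg.map_pt {A B : Alg E} (f : A ⟶ B) : Alg.fn f A.pt = B.pt :=
  congrArg (fun m : Alg.triv E ⟶ B => Alg.fn m PUnit.unit) zero_comp

theorem Alg.hom_triv_ext {A : Alg E} (f g : Alg.triv E ⟶ A) : f = g := by
  apply Alg.hom_ext
  intro a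
  obtain rfl : a = (Alg.triv E).pt := Subsingleton.elim _ _
  rw [Alg.map_pt, Alg.map_pt]

end Algebraic

/-! ### Free algebras on one generator and Jónsson–Tarski terms -/

section Free

/-- Two terms in one variable are identified when they agree in every algebra. -/
def termSetoid (E : Set (L.Term ℕ × L.Term ℕ)) : Setoid (L.Term Unit) where
  r s t := ∀ (A : Alg E) (v : Unit → A.carrier), s.realize v = t.realize v
  iseqv := ⟨fun _ _ _ => rfl, fun h A v => (h A v).symm, fun h h' A v => (h A v).trans (h' A v)⟩

theorem realize_out_mk (t : L.Term Unit) (A : Alg E) (v : Unit → A.carrier) :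
    (Quotient.mk (termSetoid E) t).out.realize v = t.realize v :=
  Quotient.mk_out (s := termSetoid E) t A v

/-- A subalgebra, as an algebra. -/
def Alg.sub (A : Alg E) (S : L.Substructure A.carrier) : Alg E :=
  ⟨S, Satisfies.of_injective A.satisfies S.subtype.toHom Subtype.val_injective⟩

/-- The inclusion of a subalgebra. -/
def Alg.subι (A : Alg E) (S : L.Substructure A.carrier) : A.sub S ⟶ A :=
  ⟨S.subtype.toHom⟩

theorem Alg.subι_injective (A : Alg E) (S : L.Substructure A.carrier) :
    Function.Injective (Alg.fn (A.subι S)) := Subtype.val_injective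

theorem Alg.sub_hom_ext {Z A : Alg E} {S : L.Substructure A.carrier} {f g : Z ⟶ A.sub S}
    (h : f ≫ A.subι S = g ≫ A.subι S) : f = g :=
  Alg.hom_ext fun z => A.subι_injective S (congrArg (fun m => Alg.fn m z) h)

variable [L.IsAlgebraic]

noncomputable instance freeStructure (E : Set (L.Term ℕ × L.Term ℕ)) :
    L.Structure (Quotient (termSetoid E)) :=
  ⟨fun s x => Quotient.mk _ (Language.Term.func s fun i => (x i).out), fun r => isEmptyElim r⟩

/-- Evaluation in the quotient is substitution of representatives, so each identity of `E` in the
free algebra reduces to the same identity in every algebra. -/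
theorem realize_free {α : Type*} (t : L.Term α) (x : α → Quotient (termSetoid E)) :
    t.realize x = Quotient.mk _ (t.subst fun a => (x a).out) := by
  induction t with
  | var a => exact (Quotient.out_eq _).symm
  | func s ts ih =>
    refine Quotient.sound fun A v => ?_
    simp only [Language.Term.realize, Language.Term.subst]
    congr 1
    funext i
    rw [ih i, realize_out_mk]

/-- The free algebra on one generator. -/
noncomputable def freeAlg (E : Set (L.Term ℕ × L.Term ℕ)) : Alg E where
  carrier := Quotient (termSetoid E)
  satisfies e he x := by
    rw [realize_free, realize_free]
    refine Quotient.sound fun A v => ?_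
    rw [Language.Term.realize_subst, Language.Term.realize_subst]
    exact A.satisfies e he _

/-- The generator of the free algebra. -/
def freeGen (E : Set (L.Term ℕ × L.Term ℕ)) : (freeAlg E).carrier :=
  Quotient.mk (termSetoid E) (Language.Term.var ())

theorem exists_realize_freeGen (y : (freeAlg E).carrier) :
    ∃ t : L.Term Unit, t.realize (fun _ => freeGen E) = y := by
  obtain ⟨t, rfl⟩ := Quotient.exists_rep y
  refine ⟨t, (realize_free (E := E) t _).trans (Quotient.sound fun A v => ?_)⟩
  rw [Language.Term.realize_subst]
  congr 1
  funext i
  exact realize_out_mk _ A v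

/-- The morphism from the free algebra which sends the generator to a given element. -/
noncomputable def freeLift {A : Alg E} (a : A.carrier) : freeAlg E ⟶ A :=
  Alg.mkHom (A := freeAlg E)
    (fun y : Quotient (termSetoid E) => y.out.realize fun _ => a) fun s x => by
      refine (realize_out_mk _ A _).trans ?_
      rfl

theorem freeLift_gen {A : Alg E} (a : A.carrier) : Alg.fn (freeLift a) (freeGen E) = a :=
  realize_out_mk _ A _

/-- The product of two algebras. -/
def Alg.prod (A B : Alg E) : Alg E :=
  letI : L.Structure (A.carrier × B.carrier) :=
    ⟨fun s x => (Language.Structure.funMap s fun i => (x i).1,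
      Language.Structure.funMap s fun i => (x i).2), fun r => isEmptyElim r⟩
  ⟨A.carrier × B.carrier, fun e he x => by
    have h₁ : ∀ t : L.Term ℕ, (t.realize x).1 = t.realize fun i => (x i).1 := fun t => by
      induction t with
      | var => rfl
      | func s ts ih => exact congrArg (Language.Structure.funMap s) (funext ih)
    have h₂ : ∀ t : L.Term ℕ, (t.realize x).2 = t.realize fun i => (x i).2 := fun t => by
      induction t with
      | var => rfl
      | func s ts ih => exact congrArg (Language.Structure.funMap s) (funext ih)
    refine Prod.ext ?_ ?_
    · rw [h₁, h₁]; exact A.satisfies e he _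
    · rw [h₂, h₂]; exact B.satisfies e he _⟩

/-- The first projection. -/
def Alg.fst (A B : Alg E) : A.prod B ⟶ A :=
  Alg.mkHom (A := A.prod B) (fun p : A.carrier × B.carrier => p.1) fun _ _ => rfl

/-- The second projection. -/
def Alg.snd (A B : Alg E) : A.prod B ⟶ B :=
  Alg.mkHom (A := A.prod B) (fun p : A.carrier × B.carrier => p.2) fun _ _ => rfl

/-- The morphism to a product with given components. -/
def Alg.pair {A B Z : Alg E} (f : Z ⟶ A) (g : Z ⟶ B) : Z ⟶ A.prod B :=
  Alg.mkHom (B := A.prod B)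
    (fun z => ((Alg.fn f z, Alg.fn g z) : A.carrier × B.carrier)) fun s x =>
      Prod.ext ((Alg.fn f).map_fun s x) ((Alg.fn g).map_fun s x)

theorem Alg.prod_ext {A B : Alg E} {p q : (A.prod B).carrier}
    (h₁ : Alg.fn (Alg.fst A B) p = Alg.fn (Alg.fst A B) q)
    (h₂ : Alg.fn (Alg.snd A B) p = Alg.fn (Alg.snd A B) q) : p = q :=
  Prod.ext h₁ h₂

/-- A morphism whose image lies in a subalgebra. -/
def Alg.subLift {Z A : Alg E} {S : L.Substructure A.carrier} (f : Z ⟶ A)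
    (hf : ∀ z, Alg.fn f z ∈ S) : Z ⟶ A.sub S :=
  Alg.mkHom (B := A.sub S) (fun z => (⟨Alg.fn f z, hf z⟩ : S)) fun s x =>
    Subtype.ext ((Alg.fn f).map_fun s x)

variable [HasZeroMorphisms (Alg E)]

/-- The split extension given by a subalgebra of `A × B` which contains both `A × 0`
and `0 × B`. -/
def subSplitExtension {A B : Alg E} (S : L.Substructure (A.prod B).carrier)
    (h₁ : ∀ a, Alg.fn (Alg.pair (𝟙 A) (0 : A ⟶ B)) a ∈ S)
    (h₂ : ∀ b, Alg.fn (Alg.pair (0 : B ⟶ A) (𝟙 B)) b ∈ S) : SplitExtension (Alg E) where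
  X := A
  A := (A.prod B).sub S
  B := B
  κ := Alg.subLift _ h₁
  α := (A.prod B).subι S ≫ Alg.snd A B
  β := Alg.subLift _ h₂
  section_eq := rfl
  isKernel := by
    rw [isKernelOf_iff]
    -- An element with zero second coordinate is determined by its first, so the lift is the first
    -- projection.
    refine ⟨rfl, fun {Z} h hh => ⟨h ≫ (A.prod B).subι S ≫ Alg.fst A B, ?_, ?_⟩⟩
    · refine Alg.sub_hom_ext (Alg.hom_ext fun z => Alg.prod_ext rfl ?_)
      exact (Alg.zero_apply (A := A) _).trans
        ((Alg.zero_apply (A := Z) z).symm.trans (congrArg (fun m => Alg.fn m z) hh.symm))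
    · rintro m rfl
      rfl

/-- The algebras of a pointed protomodular variety have a binary term `w` with
`w(x, 0) = x = w(0, x)`. -/
theorem exists_jonssonTarski_term (h : IsPointedProtomodular (Alg E)) :
    ∃ t : L.Term Bool, ∀ (A : Alg E) (a : A.carrier),
      t.realize (fun b => if b then a else A.pt) = a ∧
      t.realize (fun b => if b then A.pt else a) = a := by
  let F := freeAlg E
  let j₁ : F ⟶ F.prod F := Alg.pair (𝟙 F) 0
  let j₂ : F ⟶ F.prod F := Alg.pair 0 (𝟙 F)
  let v : Bool → (F.prod F).carrier := fun b =>
    if b then Alg.fn j₁ (freeGen E) else Alg.fn j₂ (freeGen E)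
  -- The subalgebra generated by `(x,0)` and `(0,x)`, with `x` the free generator.
  let S : L.Substructure (F.prod F).carrier :=
    { carrier := {p | ∃ t : L.Term Bool, t.realize v = p}
      fun_mem := fun {n} s x hx => by
        choose ts hts using hx
        refine ⟨Language.Term.func s ts, ?_⟩
        exact congrArg (Language.Structure.funMap s) (funext hts) }
  have h₁ : ∀ y, Alg.fn j₁ y ∈ S := fun y => by
    obtain ⟨t, rfl⟩ := exists_realize_freeGen y
    refine ⟨t.relabel fun _ => true, ?_⟩
    rw [Language.Term.realize_relabel]
    exact Language.HomClass.realize_term (Alg.fn j₁)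
  have h₂ : ∀ y, Alg.fn j₂ y ∈ S := fun y => by
    obtain ⟨t, rfl⟩ := exists_realize_freeGen y
    refine ⟨t.relabel fun _ => false, ?_⟩
    rw [Language.Term.realize_relabel]
    exact Language.HomClass.realize_term (Alg.fn j₂)
  let g : (F.prod F).sub S ⟶ (F.prod F).sub ⊤ := Alg.subLift ((F.prod F).subι S) fun _ => trivial
  let φ : (subSplitExtension S h₁ h₂).Hom
      (subSplitExtension ⊤ (fun _ => trivial) (fun _ => trivial)) :=
    { f := 𝟙 F
      g := g
      h := 𝟙 F
      comm_κ := rfl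
      comm_β := rfl
      comm_α := rfl }
  -- The inclusion of `S` in the whole product is the identity on kernels and bases, so `S` is
  -- everything.
  have hiso : IsIso g := h.splitShortFive _ _ φ (inferInstanceAs (IsIso (𝟙 F)))
    (inferInstanceAs (IsIso (𝟙 F)))
  let d : F ⟶ F.prod F := Alg.pair (𝟙 F) (𝟙 F)
  let d' : F ⟶ (F.prod F).sub ⊤ := Alg.subLift d fun _ => trivial
  have hd : Alg.fn d (freeGen E) ∈ S := by
    have e : (d' ≫ inv g) ≫ g ≫ (F.prod F).subι ⊤ = d := by
      rw [Category.assoc, IsIso.inv_hom_id_assoc]; rfl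
    have := (Alg.fn (d' ≫ inv g) (freeGen E) : S).2
    rw [← e]
    exact this
  -- Membership of `(x,x)` in `S` is an equation `(x,x) = t((x,0),(0,x))`; its two coordinates, with
  -- `x` sent to `a`, are the two required identities.
  obtain ⟨t, ht⟩ := hd
  refine ⟨t, fun A a => ⟨?_, ?_⟩⟩
  · have e := congrArg (Alg.fn (Alg.fst F F ≫ freeLift a)) ht
    rw [← Language.HomClass.realize_term] at e
    refine Eq.trans ?_ (e.trans (freeLift_gen a))
    congr 1
    funext b
    cases b
    · exact ((congrArg (Alg.fn (freeLift a)) (Alg.zero_apply (A := F) _)).trans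
        (Alg.map_pt _)).symm
    · exact (freeLift_gen a).symm
  · have e := congrArg (Alg.fn (Alg.snd F F ≫ freeLift a)) ht
    rw [← Language.HomClass.realize_term] at e
    refine Eq.trans ?_ (e.trans (freeLift_gen a))
    congr 1
    funext b
    cases b
    · exact (freeLift_gen a).symm
    · exact ((congrArg (Alg.fn (freeLift a)) (Alg.zero_apply (A := F) _)).trans
        (Alg.map_pt _)).symm

end Free

end SemiAbelianWNH

namespace SemiAbelianWNH

variable {L : FirstOrder.Language.{u, w}} {E : Set (L.Term ℕ × L.Term ℕ)}

/-! ### Topological algebras over algebras -/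

namespace TopAlg

/-- The underlying algebra of a topological algebra. -/
abbrev alg (A : TopAlg E) : Alg E := ⟨A.carrier, A.satisfies⟩

/-- Continuity of a morphism between the underlying algebras of topological algebras. -/
abbrev Cont (A B : TopAlg E) (f : A.alg ⟶ B.alg) : Prop :=
  Continuous (Alg.fn f : A.carrier → B.carrier)

/-- The underlying morphism of algebras of a continuous homomorphism. -/
abbrev algHom {A B : TopAlg E} (f : A ⟶ B) : A.alg ⟶ B.alg := ⟨TopAlg.Hom.hom f⟩

theorem continuous_algHom {A B : TopAlg E} (f : A ⟶ B) : Cont A B (algHom f) :=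
  TopAlg.Hom.continuous_hom f

/-- A continuous homomorphism from a morphism of algebras. -/
abbrev ofAlgHom {A B : TopAlg E} (f : A.alg ⟶ B.alg) (hf : Cont A B f) : A ⟶ B := ⟨Alg.fn f, hf⟩

theorem algHom_injective {A B : TopAlg E} {f g : A ⟶ B} (h : algHom f = algHom g) : f = g :=
  TopAlg.Hom.ext (congrArg Alg.Hom.hom h)

theorem continuous_realize (A : TopAlg E) {α : Type*} (t : L.Term α) :
    Continuous fun v : α → A.carrier => t.realize v := by
  induction t with
  | var a => exact continuous_apply a
  | func s ts ih => exact (A.continuous_op s).comp (continuous_pi ih)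

theorem continuous_of_realize {A B : TopAlg E} (t : L.Term Bool) (f g : A ⟶ B)
    (φ : A.alg ⟶ B.alg)
    (h : ∀ a : A.carrier, Alg.fn φ a = t.realize (M := B.carrier) fun b : Bool =>
      if b then Alg.fn (algHom f) a else Alg.fn (algHom g) a) : Cont A B φ := by
  refine Continuous.congr ?_ fun a => (h a).symm
  refine (continuous_realize B t).comp (continuous_pi fun b => ?_)
  cases b
  · exact continuous_algHom g
  · exact continuous_algHom f

/-- An algebra with the initial topology for a set of morphisms to topological algebras. -/
abbrev initial (A : Alg E) (S : Set (Σ B : TopAlg E, A ⟶ B.alg)) : TopAlg E :=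
  letI : TopologicalSpace A.carrier :=
    ⨅ p ∈ S, TopologicalSpace.induced (Alg.fn p.2 : A.carrier → p.1.carrier) p.1.top
  { carrier := A.carrier
    satisfies := A.satisfies
    continuous_op := fun {n} s => by
      refine continuous_iInf_rng.2 fun p => continuous_iInf_rng.2 fun hp =>
        continuous_induced_rng.2 ?_
      have hc : Continuous (Alg.fn p.2 : A.carrier → p.1.carrier) :=
        continuous_iInf_dom (i := p) (continuous_iInf_dom (i := hp) continuous_induced_dom)
      have e : (Alg.fn p.2 : A.carrier → p.1.carrier) ∘
          (fun x : Fin n → A.carrier => Language.Structure.funMap s x) =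
          (fun x => Language.Structure.funMap s x) ∘ fun x : Fin n → A.carrier =>
            (Alg.fn p.2 : A.carrier → p.1.carrier) ∘ x :=
        funext fun x => (Alg.fn p.2).map_fun s x
      rw [e]
      exact (p.1.continuous_op s).comp
        (continuous_pi fun i => hc.comp (continuous_apply i)) }

theorem continuous_initial_iff {A : Alg E} {S : Set (Σ B : TopAlg E, A ⟶ B.alg)}
    {Z : TopAlg E} (f : Z.alg ⟶ A) :
    Cont Z (initial A S) f ↔ ∀ p ∈ S, Cont Z p.1 (f ≫ p.2) :=
  continuous_iInf_rng.trans <| forall_congr' fun _ =>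
    continuous_iInf_rng.trans <| forall_congr' fun _ => continuous_induced_rng

theorem continuous_of_mem {A : Alg E} {S : Set (Σ B : TopAlg E, A ⟶ B.alg)}
    {B : TopAlg E} {f : A ⟶ B.alg} (hf : ⟨B, f⟩ ∈ S) : Cont (initial A S) B f :=
  (continuous_initial_iff (Z := initial A S) (𝟙 A)).1
    (continuous_algHom (𝟙 (initial A S))) ⟨B, f⟩ hf

/-- An algebra with the indiscrete topology. -/
abbrev indiscrete (A : Alg E) : TopAlg E := initial A ∅

theorem continuous_indiscrete {A : Alg E} {Z : TopAlg E} (f : Z.alg ⟶ A) :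
    Cont Z (indiscrete A) f :=
  (continuous_initial_iff f).2 fun _ hp => hp.elim

/-- An algebra with the discrete topology. -/
abbrev discrete (A : Alg E) : TopAlg E :=
  letI : TopologicalSpace A.carrier := ⊥
  haveI : DiscreteTopology A.carrier := ⟨rfl⟩
  { carrier := A.carrier
    satisfies := A.satisfies
    continuous_op := fun _ => continuous_of_discreteTopology }

theorem continuous_discrete {A : Alg E} {Z : TopAlg E} (f : A ⟶ Z.alg) :
    Cont (discrete A) Z f :=
  continuous_bot

/-- The target of a morphism from a topological algebra, with the final topology. -/
abbrev final {A : TopAlg E} {Q : Alg E} (q : A.alg ⟶ Q) : TopAlg E :=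
  initial Q {p | Cont A p.1 (q ≫ p.2)}

theorem continuous_final {A : TopAlg E} {Q : Alg E} (q : A.alg ⟶ Q) :
    Cont A (final q) q :=
  (continuous_initial_iff _).2 fun _ hp => hp

/-- Holds by construction: the topology on `Q` is initial for exactly those homomorphisms whose
composite with `q` is continuous. This keeps the operations continuous without describing open sets.
-/
theorem continuous_of_final {A B : TopAlg E} {Q : Alg E} {q : A.alg ⟶ Q} (f : Q ⟶ B.alg)
    (hf : Cont A B (q ≫ f)) :
    Cont (final q) B f :=
  continuous_of_mem hf

/-- A continuous homomorphism is inducing when its domain carries the induced topology,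
expressed through the universal property. -/
def Inducing {A B : TopAlg E} (f : A ⟶ B) : Prop :=
  ∀ ⦃Z : TopAlg E⦄ (g : Z.alg ⟶ A.alg), Cont Z B (g ≫ algHom f) → Cont Z A g

theorem Inducing.comp {A B D : TopAlg E} {f : A ⟶ B} {g : B ⟶ D} (hf : Inducing f)
    (hg : Inducing g) : Inducing (f ≫ g) :=
  fun _ h hh => hf h (hg (h ≫ algHom f) hh)

/-! ### Kernels, cokernels and commutation under the forgetful functor -/

section Pointed

variable [L.IsAlgebraic] [HasZeroMorphisms (Alg E)]

instance hasZeroMorphisms : HasZeroMorphisms (TopAlg E) where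
  zero A B := ⟨ofAlgHom (A := A) (B := B) 0
    (continuous_const.congr fun a => (Alg.zero_apply (A := A.alg) (B := B.alg) a).symm)⟩
  comp_zero f C := algHom_injective (comp_zero (f := algHom f) (Z := C.alg))
  zero_comp A _ _ f := algHom_injective (zero_comp (X := A.alg) (f := algHom f))

theorem hasZeroObject : HasZeroObject (TopAlg E) := by
  refine ⟨⟨discrete (Alg.triv E), fun B => ⟨⟨⟨0⟩, fun f => algHom_injective
    (Alg.hom_triv_ext (A := B.alg) _ _)⟩⟩, fun B => ⟨⟨⟨0⟩, fun f => algHom_injective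
    (Alg.hom_ext fun b => Subsingleton.elim (α := PUnit) _ _)⟩⟩⟩⟩

/-- Every homomorphism out of a discrete algebra is continuous, so discrete test objects suffice. -/
theorem isKernelOf_algHom {K X Y : TopAlg E} {k : K ⟶ X} {f : X ⟶ Y} (h : IsKernelOf k f) :
    IsKernelOf (algHom k) (algHom f) := by
  rw [isKernelOf_iff] at h ⊢
  refine ⟨congrArg algHom h.1, fun {Z} g hg => ?_⟩
  obtain ⟨l, hl, hu⟩ := h.2 (Z := discrete Z) (ofAlgHom g (continuous_discrete _))
    (algHom_injective hg)
  exact ⟨algHom l, congrArg algHom hl, fun m hm => congrArg algHom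
    (hu (ofAlgHom m (continuous_discrete _)) (algHom_injective hm))⟩

/-- Dually, test with indiscrete targets. -/
theorem isCokernelOf_algHom {X Y Q : TopAlg E} {q : Y ⟶ Q} {f : X ⟶ Y} (h : IsCokernelOf q f) :
    IsCokernelOf (algHom q) (algHom f) := by
  rw [isCokernelOf_iff] at h ⊢
  refine ⟨congrArg algHom h.1, fun {Z} g hg => ?_⟩
  obtain ⟨l, hl, hu⟩ := h.2 (Z := indiscrete Z) (ofAlgHom g (continuous_indiscrete _))
    (algHom_injective hg)
  exact ⟨algHom l, congrArg algHom hl, fun m hm => congrArg algHom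
    (hu (ofAlgHom m (continuous_indiscrete _)) (algHom_injective hm))⟩

theorem isNormalMonomorphism_algHom {K X : TopAlg E} {k : K ⟶ X} (h : IsNormalMonomorphism k) :
    IsNormalMonomorphism (algHom k) := by
  rw [isNormalMonomorphism_iff] at h ⊢
  obtain ⟨Y, f, h⟩ := h
  exact ⟨_, _, isKernelOf_algHom h⟩

/-- The continuous composite factors continuously through the kernel, and the factor is `g` since
`k` is monic on underlying algebras. -/
theorem inducing_of_isNormalMonomorphism {K X : TopAlg E} {k : K ⟶ X}
    (h : IsNormalMonomorphism k) : Inducing k := by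
  intro Z g hg
  have hm := (isNormalMonomorphism_algHom h).mono
  rw [isNormalMonomorphism_iff] at h
  obtain ⟨Y, f, h⟩ := h
  rw [isKernelOf_iff] at h
  obtain ⟨l, hl, -⟩ := h.2 (ofAlgHom (g ≫ algHom k) hg) <| algHom_injective <| by
    have e : algHom k ≫ algHom f = 0 := congrArg algHom h.1
    exact (Category.assoc g (algHom k) (algHom f)).trans (by rw [e, comp_zero]; rfl)
  have : algHom l = g := (cancel_mono (algHom k)).1 (congrArg algHom hl)
  rw [← this]
  exact continuous_algHom l

theorem isNormalMonomorphism_of_algHom {K X : TopAlg E} {k : K ⟶ X} (hk : Inducing k)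
    (h : IsNormalMonomorphism (algHom k)) : IsNormalMonomorphism k := by
  rw [isNormalMonomorphism_iff] at h ⊢
  obtain ⟨Y, f, h⟩ := h
  -- The indiscrete topology on `Y` makes `f` continuous at no cost.
  refine ⟨indiscrete Y, ofAlgHom f (continuous_indiscrete _), ?_⟩
  rw [isKernelOf_iff] at h ⊢
  refine ⟨algHom_injective h.1, fun {Z} g hg => ?_⟩
  obtain ⟨l, hl, hu⟩ := h.2 (algHom g) (congrArg algHom hg)
  have hc : Cont Z K l :=
    hk l (by rw [hl]; exact continuous_algHom g)
  exact ⟨ofAlgHom l hc, algHom_injective hl, fun m hm =>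
    algHom_injective (hu (algHom m) (congrArg algHom hm))⟩

theorem isCokernelOf_final {X Y : TopAlg E} {Q : Alg E} {q : Y.alg ⟶ Q} {f : X ⟶ Y}
    (h : IsCokernelOf q (algHom f)) :
    IsCokernelOf (ofAlgHom (B := final q) q (continuous_final q)) f := by
  rw [isCokernelOf_iff] at h ⊢
  refine ⟨algHom_injective h.1, fun {Z} g hg => ?_⟩
  obtain ⟨l, hl, hu⟩ := h.2 (algHom g) (congrArg algHom hg)
  have hc : Cont (final q) Z l :=
    continuous_of_final l (by rw [hl]; exact continuous_algHom g)
  exact ⟨ofAlgHom l hc, algHom_injective hl, fun m hm =>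
    algHom_injective (hu (algHom m) (congrArg algHom hm))⟩

theorem huqCommute_algHom {A B X : TopAlg E} {f : A ⟶ X} {g : B ⟶ X} (h : HuqCommute f g) :
    HuqCommute (algHom f) (algHom g) := by
  rw [huqCommute_iff] at h ⊢
  obtain ⟨P, p₁, p₂, i₁, i₂, φ, hP, h₁₁, h₁₂, h₂₁, h₂₂, h₁, h₂⟩ := h
  refine ⟨P.alg, algHom p₁, algHom p₂, algHom i₁, algHom i₂, algHom φ, fun {Z} a b => ?_,
    congrArg algHom h₁₁, congrArg algHom h₁₂, congrArg algHom h₂₁, congrArg algHom h₂₂,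
    congrArg algHom h₁, congrArg algHom h₂⟩
  obtain ⟨l, hl, hu⟩ := hP (Z := discrete Z) (ofAlgHom a (continuous_discrete _))
    (ofAlgHom b (continuous_discrete _))
  exact ⟨algHom l, ⟨congrArg algHom hl.1, congrArg algHom hl.2⟩, fun m hm => congrArg algHom
    (hu (ofAlgHom m (continuous_discrete _)) ⟨algHom_injective hm.1, algHom_injective hm.2⟩)⟩

theorem commuteModulo_algHom {A B N X : TopAlg E} {n : N ⟶ X} {f : A ⟶ X} {g : B ⟶ X}
    (h : CommuteModulo n f g) : CommuteModulo (algHom n) (algHom f) (algHom g) := by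
  obtain ⟨Q, q, hq, hc⟩ := h
  exact ⟨Q.alg, algHom q, isCokernelOf_algHom hq, huqCommute_algHom hc⟩

end Pointed

end TopAlg

/-- If the maps from a test algebra to a product are determined by their components, then so are
its elements. -/
theorem Alg.ext_of_isProduct [L.IsAlgebraic] {P A B : Alg E} (p₁ : P ⟶ A) (p₂ : P ⟶ B)
    (hP : ∀ {Z : Alg E} (a : Z ⟶ A) (b : Z ⟶ B), ∃! l : Z ⟶ P, l ≫ p₁ = a ∧ l ≫ p₂ = b)
    {x y : P.carrier} (h₁ : Alg.fn p₁ x = Alg.fn p₁ y) (h₂ : Alg.fn p₂ x = Alg.fn p₂ y) :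
    x = y := by
  -- Elements of `P` correspond to homomorphisms from the free algebra on one generator, to which
  -- the universal property applies.
  have free_ext : ∀ {D : Alg E} {m n : freeAlg E ⟶ D},
      Alg.fn m (freeGen E) = Alg.fn n (freeGen E) → m = n := fun {D m n} h =>
    Alg.hom_ext fun z => by
      obtain ⟨t, rfl⟩ := exists_realize_freeGen z
      rw [← Language.HomClass.realize_term, ← Language.HomClass.realize_term]
      congr 1
      funext i
      exact h
  have key : freeLift x = freeLift y := (hP (freeLift y ≫ p₁) (freeLift y ≫ p₂)).unique
    ⟨free_ext (by
      rw [Alg.comp_apply, Alg.comp_apply, freeLift_gen, freeLift_gen, h₁]),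
     free_ext (by
      rw [Alg.comp_apply, Alg.comp_apply, freeLift_gen, freeLift_gen, h₂])⟩ ⟨rfl, rfl⟩
  rw [← freeLift_gen x, key, freeLift_gen]

/-! ### Reflection of commutation, commutators and (WNH) -/

namespace TopAlg

variable [L.IsAlgebraic] [HasZeroMorphisms (Alg E)]

theorem huqCommute_of_algHom (hp : IsPointedProtomodular (Alg E)) {A B X : TopAlg E}
    {f : A ⟶ X} {g : B ⟶ X} (h : HuqCommute (algHom f) (algHom g)) : HuqCommute f g := by
  obtain ⟨t, ht⟩ := exists_jonssonTarski_term hp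
  rw [huqCommute_iff] at h ⊢
  obtain ⟨P, p₁, p₂, i₁, i₂, φ, hP, h₁₁, h₁₂, h₂₁, h₂₂, h₁, h₂⟩ := h
  -- The initial topology for the projections makes `P` a product of topological algebras.
  let S : Set (Σ D : TopAlg E, P ⟶ D.alg) := {⟨A, p₁⟩, ⟨B, p₂⟩}
  have c₁ : Cont (initial P S) A p₁ :=
    continuous_of_mem (Or.inl rfl)
  have c₂ : Cont (initial P S) B p₂ :=
    continuous_of_mem (Or.inr rfl)
  have cP : ∀ {Z : TopAlg E} (l : Z.alg ⟶ P) (a : Z ⟶ A) (b : Z ⟶ B), l ≫ p₁ = algHom a →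
      l ≫ p₂ = algHom b → Cont Z (initial P S) l := by
    intro Z l a b ha hb
    refine (continuous_initial_iff _).2 fun p hpS => ?_
    rcases hpS with rfl | rfl
    · exact (continuous_algHom a).congr fun z => (congrArg (fun m => Alg.fn m z) ha).symm
    · exact (continuous_algHom b).congr fun z => (congrArg (fun m => Alg.fn m z) hb).symm
  have ev : ∀ {D D' : Alg E} {m n : D ⟶ D'} (_ : m = n) (z : D.carrier),
      Alg.fn m z = Alg.fn n z := fun h z => by rw [h]
  -- This is `(a,b) = t((a,0),(0,b))`; applying `φ` expresses it through the continuous maps `f` and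
  -- `g`.
  have decomp : ∀ z : P.carrier, z = t.realize fun b : Bool =>
      if b then Alg.fn i₁ (Alg.fn p₁ z) else Alg.fn i₂ (Alg.fn p₂ z) := by
    intro z
    refine Alg.ext_of_isProduct p₁ p₂ hP ?_ ?_
    · rw [← Language.HomClass.realize_term]
      refine ((ht A.alg (Alg.fn p₁ z)).1).symm.trans ?_
      congr 1
      funext b
      cases b
      · exact ((ev h₂₁ _).trans (Alg.zero_apply _)).symm
      · exact (ev h₁₁ _).symm
    · rw [← Language.HomClass.realize_term]
      refine ((ht B.alg (Alg.fn p₂ z)).2).symm.trans ?_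
      congr 1
      funext b
      cases b
      · exact (ev h₂₂ _).symm
      · exact ((ev h₁₂ _).trans (Alg.zero_apply _)).symm
  have cφ : Cont (initial P S) X φ := by
    have e : ∀ z : P.carrier, Alg.fn φ z = t.realize (M := X.carrier) fun b : Bool =>
        if b then Alg.fn (algHom f) (Alg.fn p₁ z) else Alg.fn (algHom g) (Alg.fn p₂ z) := by
      intro z
      conv_lhs => rw [decomp z]
      rw [← Language.HomClass.realize_term]
      congr 1
      funext b
      cases b
      · exact ev h₂ _
      · exact ev h₁ _
    exact continuous_of_realize t (ofAlgHom (A := initial P S) p₁ c₁ ≫ f)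
      (ofAlgHom (A := initial P S) p₂ c₂ ≫ g) φ e
  refine ⟨initial P S, ofAlgHom p₁ c₁, ofAlgHom p₂ c₂, ofAlgHom i₁ (cP i₁ (𝟙 A) 0 h₁₁ h₁₂),
    ofAlgHom i₂ (cP i₂ 0 (𝟙 B) h₂₁ h₂₂), ofAlgHom φ cφ, fun {Z} a b => ?_,
    algHom_injective h₁₁, algHom_injective h₁₂, algHom_injective h₂₁, algHom_injective h₂₂,
    algHom_injective h₁, algHom_injective h₂⟩
  obtain ⟨l, hl, hu⟩ := hP (algHom a) (algHom b)
  exact ⟨ofAlgHom l (cP l a b hl.1 hl.2), ⟨algHom_injective hl.1, algHom_injective hl.2⟩,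
    fun m hm => algHom_injective
      (hu (algHom m) ⟨congrArg algHom hm.1, congrArg algHom hm.2⟩)⟩

theorem commuteModulo_iff (hp : IsPointedProtomodular (Alg E)) {A B N X : TopAlg E} {n : N ⟶ X}
    {f : A ⟶ X} {g : B ⟶ X} :
    CommuteModulo n f g ↔ CommuteModulo (algHom n) (algHom f) (algHom g) := by
  refine ⟨commuteModulo_algHom, ?_⟩
  rintro ⟨Q, q, hq, hc⟩
  exact ⟨final q, ofAlgHom q (continuous_final q), isCokernelOf_final hq,
    huqCommute_of_algHom hp hc⟩

/-- Huq commutators of topological algebras are computed in the underlying algebras. -/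
theorem isHuqCommutator_iff (hp : IsPointedProtomodular (Alg E)) {A B D X : TopAlg E}
    {f : A ⟶ X} {g : B ⟶ X} {c : D ⟶ X} :
    IsHuqCommutator f g c ↔
      Inducing c ∧ IsHuqCommutator (algHom f) (algHom g) (algHom c) := by
  constructor
  · intro h
    refine ⟨inducing_of_isNormalMonomorphism h.normal, isNormalMonomorphism_algHom h.normal,
      commuteModulo_algHom h.commute, fun {N} n hn hc => ?_⟩
    -- To test against a purely algebraic normal monomorphism `n`, `N` receives the topology induced
    -- from `X`.
    let N' : TopAlg E := initial N {⟨X, n⟩}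
    let n' : N' ⟶ X := ofAlgHom n (continuous_of_mem rfl)
    have hi : Inducing n' := fun Z l hl =>
      (continuous_initial_iff _).2 fun p hpS => by
        obtain rfl := hpS
        exact hl
    obtain ⟨s, hs, -⟩ := h.initial n' (isNormalMonomorphism_of_algHom hi hn)
      ((commuteModulo_iff hp).2 hc)
    have := hn.mono
    exact ⟨algHom s, congrArg algHom hs, fun m hm =>
      (cancel_mono n).1 (hm.trans (congrArg algHom hs).symm)⟩
  · rintro ⟨hi, h⟩
    refine ⟨isNormalMonomorphism_of_algHom hi h.normal, (commuteModulo_iff hp).2 h.commute,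
      fun {N} n hn hc => ?_⟩
    obtain ⟨s, hs, hu⟩ := h.initial (algHom n) (isNormalMonomorphism_algHom hn)
      (commuteModulo_algHom hc)
    have hsc : Cont D N s :=
      inducing_of_isNormalMonomorphism hn s (by rw [hs]; exact continuous_algHom c)
    exact ⟨ofAlgHom s hsc, algHom_injective hs, fun m hm =>
      algHom_injective (hu (algHom m) (congrArg algHom hm))⟩

theorem wnh (hp : IsPointedProtomodular (Alg E)) (h : WNH (Alg E)) : WNH (TopAlg E) := by
  intro K X k hk D c hc
  rw [isHuqCommutator_iff hp] at hc ⊢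
  exact ⟨hc.1.comp (inducing_of_isNormalMonomorphism hk),
    h (algHom k) (isNormalMonomorphism_algHom hk) (algHom c) hc.2⟩

end TopAlg

end SemiAbelianWNH

theorem proposition3p5 {L : FirstOrder.Language.{u, w}} [L.IsAlgebraic] (E : Set (L.Term ℕ × L.Term ℕ))
    [HasZeroMorphisms (SemiAbelianWNH.Alg E)]
    (hV : SemiAbelianWNH.IsSemiAbelian (SemiAbelianWNH.Alg E)) (hWNH : SemiAbelianWNH.WNH (SemiAbelianWNH.Alg E)) :
    ∃ (_ : HasZeroObject (SemiAbelianWNH.TopAlg E)) (_ : HasZeroMorphisms (SemiAbelianWNH.TopAlg E)),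
      SemiAbelianWNH.WNH (SemiAbelianWNH.TopAlg E) :=
  ⟨SemiAbelianWNH.TopAlg.hasZeroObject, SemiAbelianWNH.TopAlg.hasZeroMorphisms,
    SemiAbelianWNH.TopAlg.wnh hV.protomodular hWNH⟩
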